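/- Let $G$ be a finite, simple, connected graph, and let $d(u,v)$ denote the distance between the vertices $u$ and $v$ of $G$. A set $W=\{w_1,\dots,w_m\}$ of vertices is a *resolving set* of $G$ if distinct vertices $v$ of $G$ have distinct vectors $(d(v,w_1),\dots,d(v,w_m))$; a *basis* of $G$ is a resolving set of minimum cardinality, and this cardinality is the *metric dimension* $\beta(G)$ of $G$. For $k=\beta(G)$, the graph $G$ is called *randomly $k$-dimensional* if every set of $k$ vertices of $G$ is a basis of $G$. Suppose that $\beta(G)=k>1$. Then $G$ is randomly $k$-dimensional if and only if $G$ is (isomorphic to) the complete graph $K_{k+1}$ or a cycle $C_n$ with $n\ge 3$ odd. -/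

import Mathlib

namespace SimpleGraph

/-- The metric representation of the vertex `v` with respect to the set of vertices `W`:
the vector of the distances from `v` to the members of `W`. -/
noncomputable def metricRepr {V : Type*} (G : SimpleGraph V) (W : Finset V) (v : V) :
    W → ℕ :=
  fun w => G.dist v w

/-- `W` is a resolving set of `G`: distinct vertices have distinct representations
with respect to `W`. -/
def IsResolvingSet {V : Type*} (G : SimpleGraph V) (W : Finset V) : Prop :=
  ∀ u v : V, u ≠ v → G.metricRepr W u ≠ G.metricRepr W v

/-- A basis of `G`: a resolving set of minimum cardinality. -/
def IsMetricBasis {V : Type*} (G : SimpleGraph V) (W : Finset V) : Prop :=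
  G.IsResolvingSet W ∧ ∀ W' : Finset V, G.IsResolvingSet W' → W.card ≤ W'.card

/-- The metric dimension of `G`: the minimum cardinality of a resolving set
(see `exists_isMetricBasis` for the existence of the minimum when `G` is finite
and connected). -/
noncomputable def metricDimension {V : Type*} (G : SimpleGraph V) : ℕ :=
  sInf {m : ℕ | ∃ W : Finset V, G.IsResolvingSet W ∧ W.card = m}

/-- `G` is randomly `k`-dimensional: `k` is the metric dimension of `G`, and every set of
`k` vertices of `G` is a basis of `G`. -/
def IsRandomlyDimensional {V : Type*} (G : SimpleGraph V) (k : ℕ) : Prop :=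
  G.metricDimension = k ∧ ∀ W : Finset V, W.card = k → G.IsMetricBasis W

/-- `G` is an odd cycle. -/
def IsOddCycle {V : Type*} (G : SimpleGraph V) : Prop :=
  ∃ n : ℕ, 3 ≤ n ∧ Odd n ∧ Nonempty (G ≃g cycleGraph n)

/-- A finite connected graph has a basis, and its cardinality is the metric dimension. -/
theorem exists_isMetricBasis {V : Type*} [Finite V] (G : SimpleGraph V) (hG : G.Connected) :
    ∃ W : Finset V, G.IsMetricBasis W ∧ W.card = G.metricDimension := by
  classical
  have := Fintype.ofFinite V
  have hne : {m : ℕ | ∃ W : Finset V, G.IsResolvingSet W ∧ W.card = m}.Nonempty := by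
    refine ⟨_, Finset.univ, ?_, rfl⟩
    intro u v huv h
    have h1 : G.dist u u = G.dist v u := congrFun h ⟨u, Finset.mem_univ u⟩
    rw [dist_self] at h1
    exact huv ((hG.dist_eq_zero_iff.mp h1.symm).symm)
  obtain ⟨W, hW, hc⟩ := Nat.sInf_mem hne
  exact ⟨W, ⟨hW, fun W' hW' => hc ▸ Nat.sInf_le ⟨W', hW', rfl⟩⟩, hc⟩

end SimpleGraph

namespace SimpleGraph

/-! Say that a vertex `w` collides on a pair `{u, v}` when it is equidistant from `u` and `v`. A set
of `k - 1` vertices is too small to resolve, so it collides on some pair; adding any further vertex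
makes it resolving, so it is exactly the set of vertices colliding on that pair (`exists_pair`).
Hence pairs map onto `(k - 1)`-sets, and with `n` vertices C(n, k - 1) ≤ C(n, 2). Since `k < n`,
this leaves `k = 2`, `k = 3` or `k = n - 1`.

If `k = n - 1`, any two vertices are twins and the graph is complete. If `k = 2`, no two vertices
collide on the same pair; this forces all degrees to be 2, and an even cycle is excluded by a
reflection with two fixed vertices.

If `k = 3`, the map from pairs to pairs is a bijection (`HasUniqueCollisions`). Double counting then
almost determines the layer sizes around a vertex (`card_layer_cases`). For `n ≥ 5` local arguments
leave only degrees 2 and 3, and a residue modulo 3 followed by a look at the last layer gives a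
contradiction (`card_lt_five`). So `n = 4 = k + 1`, which is the complete case again.

Conversely, a set missing one vertex of a complete graph resolves it, and so do any two vertices of
an odd cycle, because 2 is invertible modulo `n`. -/

/-- Pascal's rule gives C(n+1, m+1) > 2 C(n, 2) ≥ C(n, 2) + n = C(n+1, 2); the boundary cases `m =
3` and `m = n - 3` are a direct cubic estimate. -/
theorem choose_two_lt_choose {n m : ℕ} (h3 : 3 ≤ m) (hm : m + 3 ≤ n) :
    n.choose 2 < n.choose m := by
  have base : ∀ j : ℕ, 6 ≤ j → j.choose 2 < j.choose 3 := by
    intro j hj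
    have h := Nat.choose_succ_right_eq j 2
    have hpos : 0 < j.choose 2 := Nat.choose_pos (by lia)
    obtain ⟨t, rfl⟩ : ∃ t, j = t + 6 := ⟨j - 6, by lia⟩
    rw [show t + 6 - 2 = t + 4 by lia] at h
    nlinarith
  induction n generalizing m with
  | zero => lia
  | succ n ih =>
    rcases eq_or_lt_of_le hm with hm | hm
    · rw [← Nat.choose_symm (show m ≤ n + 1 by lia), show n + 1 - m = 3 by lia]
      exact base _ (by lia)
    · rcases eq_or_lt_of_le h3 with rfl | h3
      · exact base _ (by lia)
      · obtain ⟨m, rfl⟩ : ∃ t, m = t + 1 := ⟨m - 1, by lia⟩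
        have h1 := ih (m := m) (by lia) (by lia)
        have h2 := ih (m := m + 1) (by lia) (by lia)
        have h3 := Nat.choose_succ_right_eq n 1
        have h4 : n ≤ n.choose 2 := by
          obtain ⟨t, rfl⟩ : ∃ t, n = t + 3 := ⟨n - 3, by lia⟩
          rw [Nat.choose_one_right, show t + 3 - 1 = t + 2 by lia] at h3
          nlinarith
        rw [Nat.choose_succ_succ n m, Nat.choose_succ_succ n 1, Nat.choose_one_right]
        lia

/-! ### Collisions, counting, and the complete case -/

section Random

variable {V : Type*} {G : SimpleGraph V} {k : ℕ}

theorem isResolvingSet_iff {W : Finset V} :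
    G.IsResolvingSet W ↔ ∀ u v : V, u ≠ v → ∃ w ∈ W, G.dist w u ≠ G.dist w v := by
  refine forall₃_congr fun u v _ => ?_
  simp [metricRepr, funext_iff, G.dist_comm (u := u), G.dist_comm (u := v)]

theorem metricDimension_le {W : Finset V} (h : G.IsResolvingSet W) :
    G.metricDimension ≤ W.card :=
  Nat.sInf_le ⟨W, h, rfl⟩

theorem isRandomlyDimensional_of_forall_isResolvingSet (hdim : G.metricDimension = k)
    (h : ∀ W : Finset V, W.card = k → G.IsResolvingSet W) : G.IsRandomlyDimensional k :=
  ⟨hdim, fun W hW => ⟨h W hW, fun _ hW' => by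
    rw [hW, ← hdim]; exact metricDimension_le hW'⟩⟩

theorem IsRandomlyDimensional.exists_dist_ne (h : G.IsRandomlyDimensional k) {W : Finset V}
    (hW : W.card = k) {u v : V} (huv : u ≠ v) : ∃ w ∈ W, G.dist w u ≠ G.dist w v :=
  isResolvingSet_iff.1 (h.2 W hW).1 u v huv

/-- Every set with one element less than a basis is the set of all vertices equidistant from
some pair of vertices. -/
theorem IsRandomlyDimensional.exists_pair (h : G.IsRandomlyDimensional k) {S : Finset V}
    (hS : S.card + 1 = k) : ∃ u v, u ≠ v ∧ ∀ w, G.dist w u = G.dist w v ↔ w ∈ S := by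
  classical
  have hn : ¬ G.IsResolvingSet S := fun hr => by
    have := metricDimension_le hr
    have := h.1
    lia
  rw [isResolvingSet_iff] at hn
  push Not at hn
  obtain ⟨u, v, huv, hd⟩ := hn
  refine ⟨u, v, huv, fun w => ⟨fun hw => ?_, hd w⟩⟩
  by_contra hwS
  obtain ⟨x, hx, hne⟩ := h.exists_dist_ne (W := insert w S)
    (by rw [Finset.card_insert_of_notMem hwS, hS]) huv
  rcases Finset.mem_insert.1 hx with rfl | hx
  · exact hne hw
  · exact hne (hd x hx)

variable [Fintype V] [DecidableEq V]

variable (G) in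
/-- The vertices from which all members of `P` have the same distance. -/
noncomputable def equidistant (P : Finset V) : Finset V :=
  {w | ∀ u ∈ P, ∀ v ∈ P, G.dist w u = G.dist w v}

theorem mem_equidistant_pair {u v w : V} :
    w ∈ G.equidistant {u, v} ↔ G.dist w u = G.dist w v := by
  simp only [equidistant, Finset.mem_filter_univ, Finset.mem_insert, Finset.mem_singleton]
  refine ⟨fun h => h u (by simp) v (by simp), ?_⟩
  rintro h _ (rfl | rfl) _ (rfl | rfl) <;> simp [h]

theorem IsRandomlyDimensional.surjOn_equidistant (h : G.IsRandomlyDimensional k) (hk : 0 < k) :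
    Set.SurjOn G.equidistant (Finset.powersetCard 2 (Finset.univ : Finset V))
      (Finset.powersetCard (k - 1) (Finset.univ : Finset V)) := by
  intro S hS
  have hS : S.card = k - 1 := by simpa using hS
  obtain ⟨u, v, huv, hd⟩ := h.exists_pair (S := S) (by lia)
  exact ⟨{u, v}, by simp [Finset.card_pair huv], by ext w; rw [mem_equidistant_pair, hd]⟩

/-- A member of the colliding pair is at distance 0 from itself only, so both members lie outside
the `(k - 1)`-set. -/
theorem IsRandomlyDimensional.lt_card (h : G.IsRandomlyDimensional k) (hG : G.Connected)
    (hk : 0 < k) : k < Fintype.card V := by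
  obtain ⟨W, -, hW⟩ := exists_isMetricBasis G hG
  rw [h.1] at hW
  obtain ⟨S, hSW, hS⟩ := Finset.exists_subset_card_eq (s := W) (n := k - 1) (by lia)
  obtain ⟨u, v, huv, hd⟩ := h.exists_pair (S := S) (by lia)
  have hu : u ∉ S := fun hu => huv (by
    have := (hd u).2 hu
    rw [dist_self, eq_comm, hG.dist_eq_zero_iff] at this
    exact this)
  have hv : v ∉ S := fun hv => huv (by
    have := (hd v).2 hv
    rw [dist_self, hG.dist_eq_zero_iff] at this
    exact this.symm)
  have := Finset.card_le_univ (insert u (insert v S))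
  rw [Finset.card_insert_of_notMem (by simp [huv, hu]), Finset.card_insert_of_notMem hv] at this
  lia

theorem IsRandomlyDimensional.eq_two_or_eq_three_or (h : G.IsRandomlyDimensional k)
    (hG : G.Connected) (hk : 1 < k) : k = 2 ∨ k = 3 ∨ k + 1 = Fintype.card V := by
  have hlt := h.lt_card hG (by lia)
  have hc := Finset.card_le_card_of_surjOn _ (h.surjOn_equidistant (by lia))
  rw [Finset.card_powersetCard, Finset.card_powersetCard, Finset.card_univ] at hc
  by_contra! hcon
  exact hc.not_gt (choose_two_lt_choose (by lia) (by lia))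

theorem IsRandomlyDimensional.eq_top (h : G.IsRandomlyDimensional k) (hG : G.Connected)
    (hk : 1 < k) (hcard : k + 1 = Fintype.card V) : G = ⊤ := by
  -- The complement of `{u, v}` has `k - 1` elements, and the pair it collides on avoids it, hence
  -- is `{u, v}` itself.
  have twin : ∀ u v w, u ≠ v → w ≠ u → w ≠ v → G.dist w u = G.dist w v := by
    intro u v w huv hwu hwv
    have hS : (({u, v} : Finset V)ᶜ).card + 1 = k := by
      rw [Finset.card_compl, Finset.card_pair huv]; lia
    obtain ⟨a, b, hab, hd⟩ := h.exists_pair hS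
    have ha : a = u ∨ a = v := by
      by_contra hn
      have := (hd a).2 (by simpa using hn)
      rw [dist_self, eq_comm, hG.dist_eq_zero_iff] at this
      exact hab this
    have hb : b = u ∨ b = v := by
      by_contra hn
      have := (hd b).2 (by simpa using hn)
      rw [dist_self, hG.dist_eq_zero_iff] at this
      exact hab this.symm
    have := (hd w).2 (by simp [hwu, hwv])
    rcases ha with rfl | rfl <;> rcases hb with rfl | rfl
    exacts [absurd rfl hab, this, this.symm, absurd rfl hab]
  have : Nontrivial V := Fintype.one_lt_card_iff_nontrivial.1 (by lia)
  ext u v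
  simp only [top_adj]
  refine ⟨fun h => h.ne, fun huv => ?_⟩
  obtain ⟨w, hw⟩ := hG.preconnected.exists_adj_of_nontrivial u
  by_cases hwv : w = v
  · exact hwv ▸ hw
  · have h1 := twin u w v hw.ne (Ne.symm huv) (Ne.symm hwv)
    have h2 := twin u v w huv hw.ne.symm hwv
    rw [dist_eq_one_iff_adj.2 hw.symm, eq_comm, G.dist_comm, ← h1, dist_eq_one_iff_adj] at h2
    exact h2.symm

end Random

/-! ### Distance layers around a vertex -/

section Layers

variable {V : Type*} {G : SimpleGraph V}

theorem Connected.dist_adj_le (hG : G.Connected) {w x : V} (h : G.Adj w x) (u : V) :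
    G.dist w u ≤ G.dist x u + 1 := by
  have h1 := hG.dist_triangle (u := w) (v := x) (w := u)
  rw [dist_eq_one_iff_adj.2 h] at h1
  lia

theorem Connected.exists_adj_dist_eq (hG : G.Connected) {w u : V} (h : w ≠ u) :
    ∃ x, G.Adj w x ∧ G.dist x u + 1 = G.dist w u := by
  obtain ⟨p, hp⟩ := hG.exists_walk_length_eq_dist w u
  cases p with
  | nil => exact absurd rfl h
  | @cons _ x _ hadj q =>
    refine ⟨x, hadj, ?_⟩
    have h1 := dist_le q
    have h2 := hG.dist_adj_le hadj u
    rw [Walk.length_cons] at hp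
    lia

variable (G) [Fintype V]

/-- The vertices at distance `i` from `w`. -/
noncomputable def layer (w : V) (i : ℕ) : Finset V := {u | G.dist w u = i}

variable {G}

@[simp] theorem mem_layer {w u : V} {i : ℕ} : u ∈ G.layer w i ↔ G.dist w u = i := by
  simp [layer]

theorem mem_layer_one {w u : V} : u ∈ G.layer w 1 ↔ G.Adj w u := by simp

theorem layer_zero (hG : G.Connected) (w : V) : G.layer w 0 = {w} := by
  ext u; simp [hG.dist_eq_zero_iff, eq_comm]

theorem layer_nonempty_of_succ (hG : G.Connected) {w : V} {i : ℕ}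
    (h : (G.layer w (i + 1)).Nonempty) : (G.layer w i).Nonempty := by
  obtain ⟨u, hu⟩ := h
  rw [mem_layer] at hu
  obtain ⟨x, -, hx⟩ := hG.exists_adj_dist_eq (w := u) (u := w) (by rintro rfl; simp at hu)
  exact ⟨x, by rw [mem_layer, G.dist_comm]; rw [G.dist_comm (u := u)] at hx; lia⟩

theorem layer_nonempty_of_le (hG : G.Connected) {w : V} {i j : ℕ} (hij : i ≤ j)
    (h : (G.layer w j).Nonempty) : (G.layer w i).Nonempty := by
  induction hij with
  | refl => exact h
  | step _ ih => exact ih (layer_nonempty_of_succ hG h)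

theorem Connected.dist_lt_card (hG : G.Connected) (u v : V) : G.dist u v < Fintype.card V := by
  obtain ⟨p, hp, hl⟩ := hG.exists_path_of_dist u v
  exact hl ▸ hp.length_lt

theorem sum_card_layer (hG : G.Connected) (w : V) :
    ∑ i ∈ Finset.range (Fintype.card V), (G.layer w i).card = Fintype.card V := by
  have := Finset.card_eq_sum_card_fiberwise (s := (Finset.univ : Finset V))
    (t := Finset.range (Fintype.card V)) (f := G.dist w)
    (fun u _ => by simpa using hG.dist_lt_card w u)
  rw [Finset.card_univ] at this
  exact this.symm

theorem layer_eq_empty_of_card_le (hG : G.Connected) (w : V) {i : ℕ}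
    (hi : Fintype.card V ≤ i) : G.layer w i = ∅ := by
  ext u
  have := hG.dist_lt_card w u
  simp; lia

/-- Send each vertex to a neighbour one layer closer to `w`. That neighbour is not `w`, so it has a
closer neighbour of its own; two vertices sent to it would give it degree 3. -/
theorem card_layer_succ_le [DecidableEq V] (hG : G.Connected)
    (hdeg : ∀ w, (G.layer w 1).card ≤ 2) (w : V) {i : ℕ} (hi : 1 ≤ i) :
    (G.layer w (i + 1)).card ≤ (G.layer w i).card := by
  have hp : ∀ u, ∃ x, u ≠ w → G.Adj u x ∧ G.dist w x + 1 = G.dist w u := by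
    intro u
    by_cases h : u = w
    · exact ⟨u, fun h' => absurd h h'⟩
    · obtain ⟨x, hx, hd⟩ := hG.exists_adj_dist_eq h
      exact ⟨x, fun _ => ⟨hx, by rwa [G.dist_comm, G.dist_comm (u := w)]⟩⟩
  choose f hf using hp
  have hne : ∀ {u j}, G.dist w u = j + 1 → u ≠ w := by rintro u j h rfl; simp at h
  refine Finset.card_le_card_of_injOn f ?_ ?_
  · intro u hu
    have hu : G.dist w u = i + 1 := by simpa using hu
    have := (hf u (hne hu)).2
    simp; lia
  · intro u hu v hv huv
    have hu : G.dist w u = i + 1 := by simpa using hu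
    have hv : G.dist w v = i + 1 := by simpa using hv
    by_contra hne'
    have h1 := hf u (hne hu)
    have h2 := hf v (hne hv)
    rw [← huv] at h2
    obtain ⟨j, rfl⟩ : ∃ j, i = j + 1 := ⟨i - 1, by lia⟩
    have hw : f u ≠ w := hne (j := j) (by lia)
    have h3 := hf (f u) hw
    have hcard : ({u, v, f (f u)} : Finset V).card = 3 := by
      rw [Finset.card_eq_three]
      exact ⟨u, v, f (f u), hne', by intro h; rw [← h] at h3; lia,
        by intro h; rw [← h] at h3; lia, rfl⟩
    have hsub : ({u, v, f (f u)} : Finset V) ⊆ G.layer (f u) 1 := by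
      intro y hy
      rw [mem_layer_one]
      simp only [Finset.mem_insert, Finset.mem_singleton] at hy
      rcases hy with rfl | rfl | rfl
      exacts [h1.1.symm, h2.1.symm, h3.1]
    have := Finset.card_le_card hsub
    have := hdeg (f u)
    lia

theorem card_layer_le_of_forall_card_layer_one_le [DecidableEq V] (hG : G.Connected)
    (hdeg : ∀ w, (G.layer w 1).card ≤ 2) (w : V) {i : ℕ} (hi : 1 ≤ i) :
    (G.layer w i).card ≤ (G.layer w 1).card := by
  induction i, hi using Nat.le_induction with
  | base => rfl
  | succ i hi ih => exact (card_layer_succ_le hG hdeg w hi).trans ih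

/-- If `w` has exactly three neighbours, then one of them is equidistant from the other two. -/
theorem exists_collision_of_card_layer_one_eq_three [DecidableEq V] (hG : G.Connected) {w : V}
    (h : (G.layer w 1).card = 3) :
    ∃ x u v, G.Adj w x ∧ G.Adj w u ∧ G.Adj w v ∧ u ≠ v ∧ G.dist x u = G.dist x v := by
  obtain ⟨a, b, c, hab, hac, hbc, hs⟩ := Finset.card_eq_three.1 h
  have hmem : ∀ y, G.Adj w y ↔ y = a ∨ y = b ∨ y = c := by
    intro y; rw [← mem_layer_one, hs]; simp
  have ha := (hmem a).2 (by simp)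
  have hb := (hmem b).2 (by simp)
  have hc := (hmem c).2 (by simp)
  have key : ∀ x y, x ≠ y → G.Adj w x → G.Adj w y → G.dist x y = 1 ∨ G.dist x y = 2 := by
    intro x y hxy hx hy
    have h1 := hG.dist_adj_le hx.symm y
    rw [dist_eq_one_iff_adj.2 hy] at h1
    have := hG.pos_dist_of_ne hxy
    lia
  have h1 := key a b hab ha hb
  have h2 := key a c hac ha hc
  have h3 := key b c hbc hb hc
  have e1 := G.dist_comm (u := a) (v := b)
  have e2 := G.dist_comm (u := a) (v := c)
  have e3 := G.dist_comm (u := b) (v := c)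
  by_cases h12 : G.dist a b = G.dist a c
  · exact ⟨a, b, c, ha, hb, hc, hbc, h12⟩
  by_cases h13 : G.dist b a = G.dist b c
  · exact ⟨b, a, c, hb, ha, hc, hac, h13⟩
  · exact ⟨c, a, b, hc, ha, hb, hab, by lia⟩

end Layers

/-! ### Cycles -/

section Cycle

theorem Iso.dist_map {V W : Type*} {G : SimpleGraph V} {H : SimpleGraph W} (f : G ≃g H)
    (hG : G.Connected) (u v : V) : H.dist (f u) (f v) = G.dist u v := by
  have hH : H.Connected := f.connected_iff.1 hG
  refine le_antisymm ?_ ?_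
  · obtain ⟨p, hp⟩ := hG.exists_walk_length_eq_dist u v
    rw [← hp, ← Walk.length_map f.toHom p]
    exact dist_le (p.map f.toHom)
  · obtain ⟨p, hp⟩ := hH.exists_walk_length_eq_dist (f u) (f v)
    have := dist_le (p.map f.symm.toHom)
    rw [Walk.length_map, hp] at this
    simpa using this

theorem nonempty_iso_cycleGraph_of_card_layer_one_eq_two {V : Type*} [Fintype V] [DecidableEq V]
    {G : SimpleGraph V} (hG : G.Connected) (hdeg : ∀ w, (G.layer w 1).card = 2) :
    ∃ n, 3 ≤ n ∧ Nonempty (G ≃g cycleGraph n) := by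
  have hset : ∀ w, G.neighborSet w = (G.layer w 1 : Set V) := by
    intro w; ext u; simp
  have hcyc : G.IsCycles := by
    intro w _
    rw [hset, Set.ncard_coe_finset, hdeg]
  obtain ⟨v⟩ := hG.nonempty
  obtain ⟨p, hp, -⟩ := hcyc.exists_cycle_toSubgraph_verts_eq_connectedComponentSupp
    (c := G.connectedComponentMk v) (v := v) rfl (by
      rw [hset, Finset.coe_nonempty, ← Finset.card_pos, hdeg]; lia)
  have h3 := hp.three_le_length
  obtain ⟨m, hm⟩ : ∃ m, p.length = m + 3 := ⟨p.length - 3, by lia⟩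
  obtain ⟨f⟩ := (cycleGraph_isContained_iff (n := m + 3) (by lia)).2 ⟨v, p, hp, hm⟩
  have hinj : Function.Injective f.toHom := f.injective
  -- The degrees agree, so the copy of the cycle contains every neighbour of its vertices;
  -- connectedness then makes it spanning and induced.
  have hnbr : ∀ i, ((cycleGraph (m + 3)).neighborFinset i).image f.toHom
      = G.layer (f.toHom i) 1 := by
    intro i
    refine Finset.eq_of_subset_of_card_le ?_ ?_
    · intro y hy
      obtain ⟨j, hj, rfl⟩ := Finset.mem_image.1 hy
      rw [mem_layer_one]
      exact f.toHom.map_adj (by simpa using hj)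
    · rw [hdeg, Finset.card_image_of_injective _ hinj, card_neighborFinset_eq_degree,
        cycleGraph_degree_three_le]
  have hsurj : Function.Surjective f.toHom := by
    have hwalk : ∀ a b : V, G.Walk a b → (∃ i, f.toHom i = a) → ∃ i, f.toHom i = b := by
      intro a b q
      induction q with
      | nil => exact id
      | cons h _ ih =>
        rintro ⟨i, rfl⟩
        rw [← mem_layer_one, ← hnbr] at h
        obtain ⟨j, -, hj⟩ := Finset.mem_image.1 h
        exact ih ⟨j, hj⟩
    intro u
    obtain ⟨q⟩ := hG.preconnected (f.toHom 0) u
    exact hwalk _ _ q ⟨0, rfl⟩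
  refine ⟨m + 3, by lia, ⟨RelIso.symm
    ⟨Equiv.ofBijective f.toHom (show Function.Bijective f.toHom from ⟨hinj, hsurj⟩), ?_⟩⟩⟩
  intro i j
  change G.Adj (f.toHom i) (f.toHom j) ↔ _
  refine ⟨fun h => ?_, fun h => f.toHom.map_adj h⟩
  rw [← mem_layer_one, ← hnbr] at h
  obtain ⟨l, hl, hlj⟩ := Finset.mem_image.1 h
  rw [hinj hlj] at hl
  simpa using hl

theorem cycleGraph_dist_add_nsmul_le (m : ℕ) (w : Fin (m + 3)) (l : ℕ) :
    (cycleGraph (m + 3)).dist w (w + l • 1) ≤ l ∧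
      (cycleGraph (m + 3)).dist w (w - l • 1) ≤ l := by
  have hG : (cycleGraph (m + 3)).Connected := cycleGraph_connected
  induction l with
  | zero => simp
  | succ l ih =>
    have h1 : (cycleGraph (m + 3)).Adj (w + (l + 1) • 1) (w + l • 1) := by
      rw [cycleGraph_adj, succ_nsmul]; left; abel
    have h2 : (cycleGraph (m + 3)).Adj (w - (l + 1) • 1) (w - l • 1) := by
      rw [cycleGraph_adj, succ_nsmul]; right; abel
    have h1 := hG.dist_adj_le h1 w
    have h2 := hG.dist_adj_le h2 w
    rw [(cycleGraph (m + 3)).dist_comm (v := w), (cycleGraph (m + 3)).dist_comm (v := w)] at h1 h2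
    lia

theorem eq_add_or_eq_sub_of_cycleGraph_dist_eq (m : ℕ) (w : Fin (m + 3)) (l : ℕ) :
    ∀ u, (cycleGraph (m + 3)).dist w u = l → u = w + l • 1 ∨ u = w - l • 1 := by
  have hG : (cycleGraph (m + 3)).Connected := cycleGraph_connected
  induction l with
  | zero => intro u hu; rw [hG.dist_eq_zero_iff] at hu; simp [hu]
  | succ l ih =>
    intro u hu
    obtain ⟨x, hx, hd⟩ := hG.exists_adj_dist_eq (w := u) (u := w) (by rintro rfl; simp at hu)
    rw [(cycleGraph (m + 3)).dist_comm (v := w), (cycleGraph (m + 3)).dist_comm (v := w)] at hd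
    -- Stepping back towards `w` would land at distance at most `l - 1`, so the only possible steps
    -- continue outwards.
    have hback : ∀ j, l = j + 1 → u ≠ w + j • 1 ∧ u ≠ w - j • 1 := by
      rintro j rfl
      have := cycleGraph_dist_add_nsmul_le m w j
      constructor <;> rintro rfl <;> lia
    rw [cycleGraph_adj] at hx
    have hx' : u = x + 1 ∨ u = x - 1 := by
      rcases hx with h | h
      · left; rw [← h]; abel
      · right; rw [← h]; abel
    rcases l with _ | j
    · have hxw := ih x (by lia)
      simp only [zero_nsmul, add_zero, sub_zero, or_self] at hxw
      simpa [hxw] using hx'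
    · obtain ⟨hb1, hb2⟩ := hback j rfl
      rcases ih x (by lia) with rfl | rfl <;> rcases hx' with h | h
      · left; rw [h, succ_nsmul _ (j + 1)]; abel
      · exact absurd (h.trans (by rw [succ_nsmul]; abel)) hb1
      · exact absurd (h.trans (by rw [succ_nsmul]; abel)) hb2
      · right; rw [h, succ_nsmul _ (j + 1)]; abel

theorem cycleGraph_dist_ne_of_odd {n : ℕ} (hn : 3 ≤ n) (hodd : Odd n) {w x u v : Fin n}
    (hwx : w ≠ x) (huv : u ≠ v) (h : (cycleGraph n).dist w u = (cycleGraph n).dist w v) :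
    (cycleGraph n).dist x u ≠ (cycleGraph n).dist x v := by
  obtain ⟨m, rfl⟩ : ∃ m, n = m + 3 := ⟨n - 3, by lia⟩
  intro h'
  -- Equidistance puts `u` and `v` at `y + l` and `y - l` in some order, so `y` is a midpoint, which
  -- is unique modulo an odd number.
  have key : ∀ y : Fin (m + 3),
      (cycleGraph (m + 3)).dist y u = (cycleGraph (m + 3)).dist y v → y + y = u + v := by
    intro y hy
    rcases eq_add_or_eq_sub_of_cycleGraph_dist_eq m y _ u hy with h1 | h1 <;>
      rcases eq_add_or_eq_sub_of_cycleGraph_dist_eq m y _ v rfl with h2 | h2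
    · exact absurd (h1.trans h2.symm) huv
    · generalize (cycleGraph (m + 3)).dist y v = l at h1 h2; rw [h1, h2]; abel
    · generalize (cycleGraph (m + 3)).dist y v = l at h1 h2; rw [h1, h2]; abel
    · exact absurd (h1.trans h2.symm) huv
  have hsum := (key w h).trans (key x h').symm
  have hval := congrArg Fin.val hsum
  rw [Fin.val_add, Fin.val_add, ← two_mul, ← two_mul] at hval
  have hmod : (w : ℕ) ≡ x [MOD m + 3] :=
    Nat.ModEq.cancel_left_of_coprime (Nat.coprime_two_right.2 hodd) hval
  exact hwx (Fin.ext (Nat.ModEq.eq_of_lt_of_lt hmod w.2 x.2))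

theorem exists_cycleGraph_dist_eq_of_even {n : ℕ} (hn : 3 ≤ n) (heven : Even n) :
    ∃ w x u v : Fin n, w ≠ x ∧ u ≠ v ∧ (cycleGraph n).dist w u = (cycleGraph n).dist w v ∧
      (cycleGraph n).dist x u = (cycleGraph n).dist x v := by
  obtain ⟨m, rfl⟩ : ∃ m, n = m + 3 := ⟨n - 3, by lia⟩
  obtain ⟨t, ht⟩ := heven
  -- Negation fixes 0 and `n / 2` and swaps 1 and -1.
  let f : cycleGraph (m + 3) ≃g cycleGraph (m + 3) := ⟨Equiv.neg _, by
    intro a b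
    simp only [Equiv.neg_apply, cycleGraph_adj]
    rw [neg_sub_neg, neg_sub_neg, or_comm]⟩
  have hf : ∀ w : Fin (m + 3), -w = w →
      (cycleGraph (m + 3)).dist w 1 = (cycleGraph (m + 3)).dist w (-1) := by
    intro w hw
    have := f.dist_map cycleGraph_connected w 1
    rw [← this]
    change (cycleGraph (m + 3)).dist (-w) (-1) = _
    rw [hw]
  refine ⟨0, ⟨t, by lia⟩, 1, -1, ?_, ?_, hf _ (by simp), hf _ ?_⟩
  · intro h; have := congrArg Fin.val h; simp at this; lia
  · intro h
    rw [eq_neg_iff_add_eq_zero] at h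
    have := congrArg Fin.val h
    rw [Fin.val_add] at this
    simp only [Fin.val_one, Nat.reduceAdd, Fin.val_zero] at this
    rw [Nat.mod_eq_of_lt (by lia)] at this
    lia
  · rw [neg_eq_iff_add_eq_zero]
    ext
    rw [Fin.val_add]
    simp [← ht]

end Cycle

/-! ### Dimension two -/

section TwoDimensional

variable {V : Type*} [Fintype V] [DecidableEq V] {G : SimpleGraph V}

theorem IsRandomlyDimensional.isOddCycle (h : G.IsRandomlyDimensional 2) (hG : G.Connected) :
    G.IsOddCycle := by
  have hnc : ∀ w x u v, w ≠ x → u ≠ v → G.dist w u = G.dist w v → G.dist x u ≠ G.dist x v := by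
    intro w x u v hwx huv hw hx
    obtain ⟨y, hy, hne⟩ := h.exists_dist_ne (Finset.card_pair hwx) huv
    rcases Finset.mem_insert.1 hy with rfl | hy
    · exact hne hw
    · rw [Finset.mem_singleton] at hy
      exact hne (hy ▸ hx)
  -- From a neighbour `x` of `w`, the neighbours of `w` are at distance 0, 1 or 2, so four of them
  -- would collide.
  have hle3 : ∀ w, (G.layer w 1).card ≤ 3 := by
    intro w
    by_contra! hgt
    obtain ⟨x, hx⟩ := Finset.card_pos.1 (by lia : 0 < (G.layer w 1).card)
    have hwx := mem_layer_one.1 hx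
    obtain ⟨u, hu, v, hv, huv, he⟩ := Finset.exists_ne_map_eq_of_card_lt_of_maps_to
      (s := G.layer w 1) (t := Finset.range 3) (f := fun y => G.dist x y) (by simpa using hgt)
      (by
        intro y hy
        have hy : G.Adj w y := by simpa using hy
        have := hG.dist_adj_le hwx.symm y
        rw [dist_eq_one_iff_adj.2 hy] at this
        simp; lia)
    rw [mem_layer] at hu hv
    exact hnc w x u v hwx.ne huv (hu.trans hv.symm) he
  have hle2 : ∀ w, (G.layer w 1).card ≤ 2 := by
    intro w
    by_contra! hgt
    obtain ⟨x, u, v, hx, hu, hv, huv, he⟩ :=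
      exists_collision_of_card_layer_one_eq_three hG (le_antisymm (hle3 w) hgt)
    rw [← mem_layer_one, mem_layer] at hu hv
    exact hnc w x u v hx.ne huv (hu.trans hv.symm) he
  have heq2 : ∀ w, (G.layer w 1).card = 2 := by
    intro w
    by_contra hne
    -- With at most one neighbour, every layer is at most a singleton, so `w` alone resolves the
    -- graph.
    have hall : ∀ i, (G.layer w i).card ≤ 1 := by
      intro i
      rcases Nat.eq_zero_or_pos i with rfl | hi
      · rw [layer_zero hG, Finset.card_singleton]
      · have := card_layer_le_of_forall_card_layer_one_le hG hle2 w hi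
        have := hle2 w
        lia
    have hres : G.IsResolvingSet {w} := by
      rw [isResolvingSet_iff]
      intro u v huv
      refine ⟨w, by simp, fun he => huv ?_⟩
      exact Finset.card_le_one.1 (hall (G.dist w v)) u (by simpa using he) v (by simp)
    have := metricDimension_le hres
    rw [h.1] at this
    simp at this
  obtain ⟨n, hn, ⟨f⟩⟩ := nonempty_iso_cycleGraph_of_card_layer_one_eq_two hG heq2
  refine ⟨n, hn, ?_, ⟨f⟩⟩
  by_contra hodd
  obtain ⟨w, x, u, v, hwx, huv, h1, h2⟩ :=
    exists_cycleGraph_dist_eq_of_even hn (Nat.not_odd_iff_even.1 hodd)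
  have hC := f.connected_iff.1 hG
  refine hnc (f.symm w) (f.symm x) (f.symm u) (f.symm v) (by simpa using hwx)
    (by simpa using huv) ?_ ?_
  · rw [f.symm.dist_map hC, f.symm.dist_map hC, h1]
  · rw [f.symm.dist_map hC, f.symm.dist_map hC, h2]

end TwoDimensional

/-! ### Complete graphs and odd cycles -/

section Converse

variable {V : Type*} {G : SimpleGraph V} {k : ℕ}

theorem isRandomlyDimensional_of_iso_completeGraph (hdim : G.metricDimension = k)
    (f : G ≃g completeGraph (Fin (k + 1))) : G.IsRandomlyDimensional k := by
  classical
  have hadj : ∀ u v, u ≠ v → G.Adj u v := fun u v huv =>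
    f.map_adj_iff.1 (by simpa [completeGraph] using huv)
  have : Fintype V := Fintype.ofEquiv _ f.toEquiv.symm
  have hcard : Fintype.card V = k + 1 := by
    rw [Fintype.card_congr f.toEquiv, Fintype.card_fin]
  refine isRandomlyDimensional_of_forall_isResolvingSet hdim fun W hW => ?_
  rw [isResolvingSet_iff]
  intro u v huv
  have hWc : Wᶜ.card ≤ 1 := by rw [Finset.card_compl, hW, hcard]; lia
  by_cases hu : u ∈ W
  · exact ⟨u, hu, by rw [dist_self, dist_eq_one_iff_adj.2 (hadj u v huv)]; simp⟩
  by_cases hv : v ∈ W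
  · exact ⟨v, hv, by rw [dist_self, dist_eq_one_iff_adj.2 (hadj v u huv.symm)]; simp⟩
  exact absurd (Finset.card_le_one.1 hWc u (by simpa using hu) v (by simpa using hv)) huv

theorem IsOddCycle.isRandomlyDimensional (hdim : G.metricDimension = k) (hk : 1 < k)
    (hG : G.Connected) (h : G.IsOddCycle) : G.IsRandomlyDimensional k := by
  classical
  obtain ⟨n, hn, hodd, ⟨f⟩⟩ := h
  have hres : ∀ W : Finset V, 1 < W.card → G.IsResolvingSet W := by
    intro W hW
    obtain ⟨w, hw, x, hx, hwx⟩ := Finset.one_lt_card.1 hW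
    rw [isResolvingSet_iff]
    intro u v huv
    by_contra! hcon
    have h1 := hcon w hw
    have h2 := hcon x hx
    rw [← f.dist_map hG, ← f.dist_map hG] at h1 h2
    exact cycleGraph_dist_ne_of_odd hn hodd (f.injective.ne hwx) (f.injective.ne huv) h1 h2
  exact isRandomlyDimensional_of_forall_isResolvingSet hdim fun W hW => hres W (by lia)

end Converse

/-! ### Dimension three -/

section ThreeDimensional

variable {V : Type*} [Fintype V] [DecidableEq V] {G : SimpleGraph V}

variable (G) in
/-- Any two vertices are equidistant from exactly one pair of vertices, and vice versa. -/
structure HasUniqueCollisions : Prop where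
  connected : G.Connected
  card_equidistant : ∀ {u v}, u ≠ v → (G.equidistant {u, v}).card = 2
  pair_eq_of_equidistant_eq : ∀ {u v u' v'}, u ≠ v → u' ≠ v' →
    G.equidistant {u, v} = G.equidistant {u', v'} → ({u, v} : Finset V) = {u', v'}
  exists_equidistant_eq : ∀ {w x}, w ≠ x → ∃ u v, u ≠ v ∧ G.equidistant {u, v} = {w, x}

theorem IsRandomlyDimensional.hasUniqueCollisions (h : G.IsRandomlyDimensional 3)
    (hG : G.Connected) : G.HasUniqueCollisions := by
  have hsurj := h.surjOn_equidistant (by lia)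
  rw [show 3 - 1 = 2 by rfl] at hsurj
  set P : Finset (Finset V) := Finset.powersetCard 2 Finset.univ with hP
  have himage : P ⊆ P.image G.equidistant := fun S hS => by
    obtain ⟨Q, hQ, rfl⟩ := hsurj hS
    exact Finset.mem_image_of_mem _ hQ
  have himage_eq : P = P.image G.equidistant :=
    Finset.eq_of_subset_of_card_le himage Finset.card_image_le
  have hinj : Set.InjOn G.equidistant P :=
    Finset.card_image_iff.1 (by rw [← himage_eq])
  have hmem : ∀ {u v : V}, u ≠ v → ({u, v} : Finset V) ∈ P := fun huv => by
    simp [hP, Finset.card_pair huv]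
  refine ⟨hG, fun {u v} huv => ?_, fun huv huv' he => hinj (hmem huv) (hmem huv') he,
    fun {w x} hwx => ?_⟩
  · have : G.equidistant {u, v} ∈ P := himage_eq ▸ Finset.mem_image_of_mem _ (hmem huv)
    simpa [hP] using this
  · obtain ⟨Q, hQ, he⟩ := hsurj (hmem hwx)
    have hQ : Q.card = 2 := by simpa [hP] using hQ
    obtain ⟨u, v, huv, rfl⟩ := Finset.card_eq_two.1 hQ
    exact ⟨u, v, huv, he⟩

namespace HasUniqueCollisions

variable (h : G.HasUniqueCollisions)
include h

theorem equidistant_eq {w x u v : V} (hwx : w ≠ x) (huv : u ≠ v) (hw : G.dist w u = G.dist w v)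
    (hx : G.dist x u = G.dist x v) : G.equidistant {u, v} = {w, x} := by
  symm
  refine Finset.eq_of_subset_of_card_le ?_ ?_
  · intro y hy
    rw [mem_equidistant_pair]
    rcases Finset.mem_insert.1 hy with rfl | hy
    · exact hw
    · rw [Finset.mem_singleton] at hy
      exact hy ▸ hx
  · rw [h.card_equidistant huv, Finset.card_pair hwx]

theorem pair_eq {w x u v u' v' : V} (hwx : w ≠ x) (huv : u ≠ v)
    (hw : G.dist w u = G.dist w v) (hx : G.dist x u = G.dist x v) (huv' : u' ≠ v')
    (hw' : G.dist w u' = G.dist w v') (hx' : G.dist x u' = G.dist x v') :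
    ({u, v} : Finset V) = {u', v'} :=
  h.pair_eq_of_equidistant_eq huv huv'
    ((h.equidistant_eq hwx huv hw hx).trans (h.equidistant_eq hwx huv' hw' hx').symm)

theorem mem_pair {w x u v u' v' : V} (hwx : w ≠ x) (huv : u ≠ v)
    (hw : G.dist w u = G.dist w v) (hx : G.dist x u = G.dist x v) (huv' : u' ≠ v')
    (hw' : G.dist w u' = G.dist w v') (hx' : G.dist x u' = G.dist x v') : u = u' ∨ u = v' := by
  have := h.pair_eq hwx huv hw hx huv' hw' hx'
  have hu : u ∈ ({u, v} : Finset V) := by simp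
  simpa [this] using hu

/-- Three such vertices would yield distinct pairs on which both `w` and `x` collide. -/
theorem card_le_two {w x : V} (hwx : w ≠ x) {S : Finset V} {i j : ℕ} (hi : S ⊆ G.layer w i)
    (hj : S ⊆ G.layer x j) : S.card ≤ 2 := by
  by_contra! hS
  obtain ⟨a, ha, b, hb, c, hc, hab, hac, hbc⟩ := Finset.two_lt_card.1 hS
  have hw : ∀ {y}, y ∈ S → G.dist w y = i := fun hy => mem_layer.1 (hi hy)
  have hx : ∀ {y}, y ∈ S → G.dist x y = j := fun hy => mem_layer.1 (hj hy)
  rcases h.mem_pair hwx hab ((hw ha).trans (hw hb).symm) ((hx ha).trans (hx hb).symm)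
    hbc ((hw hb).trans (hw hc).symm) ((hx hb).trans (hx hc).symm) with e | e
  exacts [hab e, hac e]

/-- Along an edge distances change by at most 1, so only three values are available to four
vertices. -/
theorem exists_collision {w x : V} (hwx : G.Adj w x) {i : ℕ} {S : Finset V}
    (hS : S ⊆ G.layer w i) (hc : 4 ≤ S.card) :
    ∃ u ∈ S, ∃ v ∈ S, u ≠ v ∧ G.dist x u = G.dist x v := by
  refine Finset.exists_ne_map_eq_of_card_lt_of_maps_to (t := Finset.Icc (i - 1) (i + 1)) ?_ ?_
  · rw [Nat.card_Icc]; lia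
  · intro y hy
    have hy := mem_layer.1 (hS hy)
    have h1 := h.connected.dist_adj_le hwx y
    have h2 := h.connected.dist_adj_le hwx.symm y
    simp; lia

theorem card_layer_one_pos (hn : 5 ≤ Fintype.card V) (w : V) : 0 < (G.layer w 1).card := by
  have : Nontrivial V := Fintype.one_lt_card_iff_nontrivial.1 (by lia)
  obtain ⟨x, hx⟩ := h.connected.preconnected.exists_adj_of_nontrivial w
  exact Finset.card_pos.2 ⟨x, mem_layer_one.2 hx⟩

theorem exists_adj (hn : 5 ≤ Fintype.card V) (w : V) : ∃ x, G.Adj w x := by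
  obtain ⟨x, hx⟩ := Finset.card_pos.1 (h.card_layer_one_pos hn w)
  exact ⟨x, mem_layer_one.1 hx⟩

theorem card_layer_le_four (hn : 5 ≤ Fintype.card V) (w : V) (i : ℕ) :
    (G.layer w i).card ≤ 4 := by
  by_contra! hgt
  obtain ⟨x, hx⟩ := h.exists_adj hn w
  obtain ⟨u, hu, v, hv, huv, he⟩ := h.exists_collision hx (Finset.Subset.refl _) hgt.le
  obtain ⟨u', hu', v', hv', huv', he'⟩ := h.exists_collision hx
    (Finset.erase_subset u (G.layer w i)) (by rw [Finset.card_erase_of_mem hu]; lia)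
  rw [Finset.mem_erase, mem_layer] at hu' hv'
  rw [mem_layer] at hu hv
  rcases h.mem_pair hx.ne huv (hu.trans hv.symm) he huv' (hu'.2.trans hv'.2.symm) he' with e | e
  exacts [hu'.1 e.symm, hv'.1 e.symm]

theorem eq_of_card_layer_eq_four (hn : 5 ≤ Fintype.card V) {w : V} {i j : ℕ}
    (hi : (G.layer w i).card = 4) (hj : (G.layer w j).card = 4) : i = j := by
  obtain ⟨x, hx⟩ := h.exists_adj hn w
  obtain ⟨u, hu, v, hv, huv, he⟩ := h.exists_collision hx (Finset.Subset.refl _) hi.ge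
  obtain ⟨u', hu', v', hv', huv', he'⟩ := h.exists_collision hx (Finset.Subset.refl _) hj.ge
  rw [mem_layer] at hu hv hu' hv'
  rcases h.mem_pair hx.ne huv (hu.trans hv.symm) he huv' (hu'.trans hv'.symm) he' with e | e
  · rw [← hu, e, hu']
  · rw [← hu, e, hv']

/-- If `x` were the only neighbour of `w`, every other vertex would be strictly closer to `x`, and
nothing would be equidistant from the two. -/
theorem two_le_card_layer_one (hn : 5 ≤ Fintype.card V) (w : V) : 2 ≤ (G.layer w 1).card := by
  by_contra! hlt
  obtain ⟨x, hx⟩ := h.exists_adj hn w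
  have hcard := h.card_equidistant hx.ne
  obtain ⟨u, hu⟩ := Finset.card_pos.1 (by lia : 0 < (G.equidistant {w, x}).card)
  rw [mem_equidistant_pair, G.dist_comm, G.dist_comm (v := x)] at hu
  by_cases hwu : w = u
  · subst hwu
    rw [dist_self, eq_comm, h.connected.dist_eq_zero_iff] at hu
    exact hx.ne hu.symm
  · obtain ⟨y, hy, hd⟩ := h.connected.exists_adj_dist_eq hwu
    have : y = x := Finset.card_le_one.1 (Nat.le_of_lt_succ hlt) y (mem_layer_one.2 hy) x
      (mem_layer_one.2 hx)
    subst this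
    lia

/-- Let `P` be the set of ordered pairs on which `w` collides, and count the collisions of all
vertices on members of `P`. Each pair has two colliding vertices; `w` contributes `|P|` and every
other vertex contributes one pair in both orders. So 2|P| = |P| + 2(n - 1). -/
theorem sum_card_layer_offDiag (w : V) :
    ∑ i ∈ Finset.range (Fintype.card V), (G.layer w i).offDiag.card + 2
      = 2 * Fintype.card V := by
  set P : Finset (V × V) := {p | p.1 ≠ p.2 ∧ G.dist w p.1 = G.dist w p.2} with hP
  have hPsum : P.card = ∑ i ∈ Finset.range (Fintype.card V), (G.layer w i).offDiag.card := by
    rw [Finset.card_eq_sum_card_fiberwise (s := P) (t := Finset.range (Fintype.card V))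
      (f := fun p => G.dist w p.1)
      (fun p _ => by simpa using h.connected.dist_lt_card w p.1)]
    refine Finset.sum_congr rfl fun i _ => congrArg _ ?_
    ext ⟨u, v⟩
    simp only [hP, Finset.mem_filter, Finset.mem_univ, true_and, Finset.mem_offDiag, mem_layer]
    constructor
    · rintro ⟨⟨h1, h2⟩, h3⟩; exact ⟨h3, h2 ▸ h3, h1⟩
    · rintro ⟨h1, h2, h3⟩; exact ⟨⟨h3, h1.trans h2.symm⟩, h1⟩
  have hcount := Finset.sum_card_bipartiteAbove_eq_sum_card_bipartiteBelow
    (s := (Finset.univ : Finset V)) (t := P)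
    (fun x p => G.dist x p.1 = G.dist x p.2)
  have hbelow : ∀ p ∈ P, ((Finset.univ : Finset V).bipartiteBelow
      (fun x p => G.dist x p.1 = G.dist x p.2) p).card = 2 := by
    intro p hp
    rw [hP, Finset.mem_filter] at hp
    rw [← h.card_equidistant hp.2.1]
    refine congrArg _ ?_
    ext x
    simp [Finset.mem_bipartiteBelow, mem_equidistant_pair]
  have habove : ∀ x ∈ (Finset.univ : Finset V).erase w, (P.bipartiteAbove
      (fun x p => G.dist x p.1 = G.dist x p.2) x).card = 2 := by
    intro x hx
    have hwx : w ≠ x := (Finset.mem_erase.1 hx).1.symm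
    obtain ⟨u, v, huv, he⟩ := h.exists_equidistant_eq hwx
    have hw : G.dist w u = G.dist w v := by rw [← mem_equidistant_pair, he]; simp
    have hx : G.dist x u = G.dist x v := by rw [← mem_equidistant_pair, he]; simp
    rw [Finset.card_eq_two]
    refine ⟨(u, v), (v, u), by simp [huv], ?_⟩
    ext ⟨a, b⟩
    simp only [hP, Finset.mem_bipartiteAbove, Finset.mem_filter, Finset.mem_univ, true_and,
      Finset.mem_insert, Finset.mem_singleton, Prod.mk.injEq]
    constructor
    · rintro ⟨⟨h1, h2⟩, h3⟩
      have ha := h.mem_pair hwx h1 h2 h3 huv hw hx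
      have hb := h.mem_pair hwx h1.symm h2.symm h3.symm huv hw hx
      rcases ha with rfl | rfl <;> rcases hb with rfl | rfl <;> simp_all
    · rintro (⟨rfl, rfl⟩ | ⟨rfl, rfl⟩)
      exacts [⟨⟨huv, hw⟩, hx⟩, ⟨⟨huv.symm, hw.symm⟩, hx.symm⟩]
  have hself : P.bipartiteAbove (fun x p => G.dist x p.1 = G.dist x p.2) w = P := by
    ext p
    simp only [Finset.mem_bipartiteAbove, hP, Finset.mem_filter]
    tauto
  rw [Finset.sum_congr rfl hbelow, ← Finset.add_sum_erase _ _ (Finset.mem_univ w),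
    Finset.sum_congr rfl habove, hself, Finset.sum_const, Finset.sum_const,
    Finset.card_erase_of_mem (Finset.mem_univ w), Finset.card_univ] at hcount
  have : 0 < Fintype.card V := Fintype.card_pos_iff.2 ⟨w⟩
  simp only [smul_eq_mul] at hcount
  lia

/-- The possible sizes of the layers around a vertex. -/
theorem card_layer_cases (hn : 5 ≤ Fintype.card V) (w : V) :
    ((∀ i, 1 ≤ i → (G.layer w i).card = 0 ∨ (G.layer w i).card = 3) ∧
      ∃ t, Fintype.card V = 1 + 3 * t) ∨
    ∃ j p q, 1 ≤ j ∧ 1 ≤ p ∧ 1 ≤ q ∧ p ≠ q ∧ (G.layer w j).card = 4 ∧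
      ((G.layer w p).card = 1 ∨ (G.layer w p).card = 2) ∧
      ((G.layer w q).card = 1 ∨ (G.layer w q).card = 2) ∧
      (∀ i, 1 ≤ i → i ≠ j → i ≠ p → i ≠ q → (G.layer w i).card = 0 ∨ (G.layer w i).card = 3) ∧
      ∃ t, Fintype.card V = 5 + (G.layer w p).card + (G.layer w q).card + 3 * t := by
  have hle := h.card_layer_le_four hn w
  have hsum := sum_card_layer h.connected w
  have hoff := h.sum_card_layer_offDiag w
  have huniq := fun i j => h.eq_of_card_layer_eq_four hn (w := w) (i := i) (j := j)
  have hout : ∀ i, Fintype.card V ≤ i → (G.layer w i).card = 0 := fun i hi => by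
    rw [layer_eq_empty_of_card_le h.connected w hi, Finset.card_empty]
  have h0 : (G.layer w 0).card = 1 := by rw [layer_zero h.connected, Finset.card_singleton]
  simp only [Finset.offDiag_card] at hoff
  set n := Fintype.card V with hnV
  set a : ℕ → ℕ := fun i => (G.layer w i).card with ha
  change ∀ i, a i ≤ 4 at hle
  change ∑ i ∈ Finset.range n, a i = n at hsum
  change ∑ i ∈ Finset.range n, (a i * a i - a i) + 2 = 2 * n at hoff
  change ∀ i j, a i = 4 → a j = 4 → i = j at huniq
  change ∀ i, n ≤ i → a i = 0 at hout
  change a 0 = 1 at h0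
  change ((∀ i, 1 ≤ i → a i = 0 ∨ a i = 3) ∧ _) ∨ ∃ j p q, 1 ≤ j ∧ 1 ≤ p ∧ 1 ≤ q ∧ p ≠ q ∧
    a j = 4 ∧ (a p = 1 ∨ a p = 2) ∧ (a q = 1 ∨ a q = 2) ∧
    (∀ i, 1 ≤ i → i ≠ j → i ≠ p → i ≠ q → a i = 0 ∨ a i = 3) ∧ ∃ t, n = 5 + a p + a q + 3 * t
  clear_value a n
  have hmem0 : 0 ∈ Finset.range n := by simp; lia
  rw [← Finset.add_sum_erase _ _ hmem0, h0] at hsum hoff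
  set I := (Finset.range n).erase 0 with hI
  have hmemI : ∀ i, 1 ≤ i → i ∉ I → a i = 0 := fun i hi hiI => hout i (by
    by_contra! hlt
    exact hiI (by simp [hI]; lia))
  have hposI : ∀ i ∈ I, 1 ≤ i := fun i hi => by simp [hI] at hi; lia
  -- Thus `a i * (3 - a i)` sums to 0 over `i ≥ 1`. Sizes 0 and 3 contribute 0, sizes 1 and 2
  -- contribute 2, and size 4, which occurs at most once, contributes -4.
  have hbal : ∑ i ∈ I, (a i * a i - a i) = ∑ i ∈ I, 2 * a i := by
    rw [← Finset.mul_sum]; lia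
  by_cases hfour : ∃ j ∈ I, a j = 4
  · right
    obtain ⟨j, hjI, hj⟩ := hfour
    rw [← Finset.add_sum_erase _ _ hjI, ← Finset.add_sum_erase _ _ hjI, hj] at hbal
    rw [← Finset.add_sum_erase _ _ hjI, hj] at hsum
    have h3 : ∀ i ∈ I.erase j, a i ≤ 3 := by
      intro i hi
      have h1 := hle i
      have h2 := fun h4 => huniq i j h4 hj
      have := (Finset.mem_erase.1 hi).1
      lia
    have hdef : ∀ i ∈ I.erase j, 2 * a i
        = (a i * a i - a i) + 2 * (if a i = 1 ∨ a i = 2 then 1 else 0) := by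
      intro i hi
      have := h3 i hi
      generalize a i = m at this ⊢
      interval_cases m <;> simp
    rw [Finset.sum_congr rfl hdef, Finset.sum_add_distrib, ← Finset.mul_sum,
      ← Finset.card_filter] at hbal
    have hcard : ((I.erase j).filter fun i => a i = 1 ∨ a i = 2).card = 2 := by lia
    obtain ⟨p, q, hpq, hpqS⟩ := Finset.card_eq_two.1 hcard
    have hS : ∀ i, i ∈ I.erase j ∧ (a i = 1 ∨ a i = 2) ↔ i = p ∨ i = q := by
      intro i
      have := Finset.ext_iff.1 hpqS i
      rwa [Finset.mem_filter, Finset.mem_insert, Finset.mem_singleton] at this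
    obtain ⟨hpI, hp⟩ := (hS p).2 (Or.inl rfl)
    obtain ⟨hqI, hq⟩ := (hS q).2 (Or.inr rfl)
    have hrest : ∀ i ∈ I.erase j, i ≠ p → i ≠ q → a i = 0 ∨ a i = 3 := by
      intro i hi h1 h2
      have h4 := h3 i hi
      have h5 : ¬ (a i = 1 ∨ a i = 2) := fun h5 => by
        rcases (hS i).1 ⟨hi, h5⟩ with e | e
        exacts [h1 e, h2 e]
      lia
    refine ⟨j, p, q, hposI j hjI, hposI p (Finset.mem_of_mem_erase hpI),
      hposI q (Finset.mem_of_mem_erase hqI), hpq, hj, hp, hq, ?_, ?_⟩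
    · intro i hi hij hip hiq
      by_cases hiI : i ∈ I
      · exact hrest i (Finset.mem_erase.2 ⟨hij, hiI⟩) hip hiq
      · exact Or.inl (hmemI i hi hiI)
    · rw [← Finset.add_sum_erase _ _ hpI,
        ← Finset.add_sum_erase _ _ (Finset.mem_erase.2 ⟨hpq.symm, hqI⟩)] at hsum
      have hdvd : 3 ∣ ∑ i ∈ ((I.erase j).erase p).erase q, a i := by
        refine Finset.dvd_sum fun i hi => ?_
        simp only [Finset.mem_erase] at hi
        rcases hrest i (by simp only [Finset.mem_erase]; tauto) hi.2.1 hi.1 with e | e <;> simp [e]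
      obtain ⟨t, ht⟩ := hdvd
      exact ⟨t, by lia⟩
  · left
    push Not at hfour
    have h3 : ∀ i ∈ I, a i ≤ 3 := by
      intro i hi
      have h1 := hle i
      have h2 := hfour i hi
      lia
    have hterm := (Finset.sum_eq_sum_iff_of_le (s := I) (f := fun i => a i * a i - a i)
      (g := fun i => 2 * a i) (fun i hi => by
        have := h3 i hi
        generalize a i = m at this ⊢
        interval_cases m <;> simp)).1 hbal
    have hrest : ∀ i ∈ I, a i = 0 ∨ a i = 3 := by
      intro i hi
      have h1 := h3 i hi
      have h2 := hterm i hi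
      generalize a i = m at h1 h2 ⊢
      interval_cases m <;> simp at h2 ⊢
    refine ⟨fun i hi => ?_, ?_⟩
    · by_cases hiI : i ∈ I
      · exact hrest i hiI
      · exact Or.inl (hmemI i hi hiI)
    · have hdvd : 3 ∣ ∑ i ∈ I, a i := by
        refine Finset.dvd_sum fun i hi => ?_
        rcases hrest i hi with e | e <;> simp [e]
      obtain ⟨t, ht⟩ := hdvd
      exact ⟨t, by lia⟩

theorem dist_eq_two {w x y : V} (hx : G.Adj w x) (hy : G.Adj w y) (hxy : x ≠ y)
    (hn : ¬ G.Adj x y) : G.dist x y = 2 := by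
  have h1 := h.connected.dist_adj_le hx.symm y
  rw [dist_eq_one_iff_adj.2 hy] at h1
  have := h.connected.one_lt_dist_of_ne_of_not_adj hxy hn
  lia

/-- Two adjacent vertices with two common neighbours have no further common distances. -/
theorem card_layer_le_two_of_common_neighbors {w b u v : V} (hwb : G.Adj w b) (hwu : G.Adj w u)
    (hwv : G.Adj w v) (hbu : G.Adj b u) (hbv : G.Adj b v) (huv : u ≠ v) {i : ℕ} (hi : 2 ≤ i) :
    (G.layer w i).card ≤ 2 := by
  have hwu' := dist_eq_one_iff_adj.2 hwu
  have hwv' := dist_eq_one_iff_adj.2 hwv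
  have hbu' := dist_eq_one_iff_adj.2 hbu
  have hbv' := dist_eq_one_iff_adj.2 hbv
  by_contra! hgt
  obtain ⟨y, hy, y', hy', hne, he⟩ := Finset.exists_ne_map_eq_of_card_lt_of_maps_to
    (s := G.layer w i) (t := {i - 1, i + 1}) (f := fun y => G.dist b y)
    (lt_of_le_of_lt Finset.card_le_two hgt) (by
      intro y hy
      have hy : G.dist w y = i := by simpa using hy
      have h1 := h.connected.dist_adj_le hwb y
      have h2 := h.connected.dist_adj_le hwb.symm y
      -- The two vertices equidistant from `w` and `b` are already `u` and `v`.
      have h3 : G.dist b y ≠ i := by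
        intro hby
        have hT := h.equidistant_eq (w := u) (x := v) huv hwb.ne
          (by rw [G.dist_comm, G.dist_comm (v := b)]; lia)
          (by rw [G.dist_comm, G.dist_comm (v := b)]; lia)
        have hyT : y ∈ G.equidistant {w, b} := by
          rw [mem_equidistant_pair, G.dist_comm, G.dist_comm (v := b)]; lia
        rw [hT, Finset.mem_insert, Finset.mem_singleton] at hyT
        rcases hyT with rfl | rfl <;> lia
      simp; lia)
  rw [mem_layer] at hy hy'
  rcases h.mem_pair hwb.ne hne (hy.trans hy'.symm) he huv (hwu'.trans hwv'.symm)
    (hbu'.trans hbv'.symm) with rfl | rfl <;> lia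

/-- Beyond layer 1 no layer exceeds size 2, so the layer of size 4 is the first, and the two small
ones must be layers 2 and 3 because nonempty layers have no gaps. -/
theorem layers_of_common_neighbors (hn : 5 ≤ Fintype.card V) {w b u v : V} (hwb : G.Adj w b)
    (hwu : G.Adj w u) (hwv : G.Adj w v) (hbu : G.Adj b u) (hbv : G.Adj b v) (huv : u ≠ v) :
    (G.layer w 2).card ≤ 2 ∧ (G.layer w 3).Nonempty ∧ ∀ i, 4 ≤ i → G.layer w i = ∅ := by
  have hle : ∀ i, 2 ≤ i → (G.layer w i).card ≤ 2 := fun i =>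
    h.card_layer_le_two_of_common_neighbors hwb hwu hwv hbu hbv huv
  have h3 : 3 ≤ (G.layer w 1).card := by
    rw [← Finset.card_eq_three.2 ⟨b, u, v, hbu.ne, hbv.ne, huv, rfl⟩]
    refine Finset.card_le_card fun y hy => ?_
    simp only [Finset.mem_insert, Finset.mem_singleton] at hy
    rw [mem_layer_one]
    rcases hy with rfl | rfl | rfl <;> assumption
  have hmono : ∀ i j, i ≤ j → 0 < (G.layer w j).card → 0 < (G.layer w i).card :=
    fun i j hij hj => Finset.card_pos.2 (layer_nonempty_of_le h.connected hij
      (Finset.card_pos.1 hj))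
  rcases h.card_layer_cases hn w with ⟨hA, -⟩ | ⟨j, p, q, hj, hp, hq, hpq, hj4, hp', hq', hrest, -⟩
  · exfalso
    have h2 : (G.layer w 2).card = 0 := by
      have := hA 2 (by lia); have := hle 2 le_rfl; lia
    have hcard := sum_card_layer h.connected w
    have h0 : (G.layer w 0).card = 1 := by rw [layer_zero h.connected, Finset.card_singleton]
    have h1 : (G.layer w 1).card = 3 := by have := hA 1 le_rfl; lia
    rw [← Finset.sum_subset (Finset.range_subset_range.2 (by lia : 2 ≤ Fintype.card V))] at hcard
    · rw [Finset.sum_range_succ, Finset.sum_range_one] at hcard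
      lia
    · intro i _ hi
      have : 1 < i := by simpa using hi
      by_contra hpos
      have := hmono 2 i this (by lia)
      lia
  · have hj1 : j = 1 := by
      by_contra hne
      have := hle j (by lia)
      lia
    subst hj1
    have hp2 : 2 ≤ p := by
      by_contra hlt
      obtain rfl : p = 1 := by lia
      lia
    have hq2 : 2 ≤ q := by
      by_contra hlt
      obtain rfl : q = 1 := by lia
      lia
    have hzero : ∀ i, 2 ≤ i → i ≠ p → i ≠ q → (G.layer w i).card = 0 := by
      intro i hi hip hiq
      have h1 := hrest i (by lia) (by lia) hip hiq
      have h2 := hle i hi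
      lia
    have h2 : 2 = p ∨ 2 = q := by
      by_contra hne
      have h1 := hzero 2 le_rfl (by tauto) (by tauto)
      have h2 := hmono 2 p hp2 (by lia)
      lia
    have h3 : 3 = p ∨ 3 = q := by
      by_contra hne
      have h1 := hzero 3 (by lia) (by tauto) (by tauto)
      have h2 := hmono 3 (max p q) (by lia) (by
        rcases max_choice p q with e | e <;> rw [e] <;> lia)
      lia
    refine ⟨hle 2 le_rfl, Finset.card_pos.1 ?_, fun i hi => Finset.card_eq_zero.1 ?_⟩
    · rcases h3 with e | e <;> rw [e] <;> lia
    · exact hzero i (by lia) (by lia) (by lia)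

/-- Otherwise a single vertex `z` is at distance 3 from `w`, and its neighbours are exactly layer 2
of `w`. As `z` has degree 2, some other layer of `z` has size 4; apart from `w`, its members are all
adjacent to `w`, against `card_le_two`. -/
theorem not_common_neighbors (hn : 5 ≤ Fintype.card V) {w b u v : V} (hwb : G.Adj w b)
    (hwu : G.Adj w u) (hwv : G.Adj w v) (hbu : G.Adj b u) (hbv : G.Adj b v) : u = v := by
  by_contra huv
  obtain ⟨hw2, hw3, hw4⟩ := h.layers_of_common_neighbors hn hwb hwu hwv hbu hbv huv
  obtain ⟨-, -, hb4⟩ := h.layers_of_common_neighbors hn hwb.symm hbu hbv hwu hwv huv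
  have hwu' := dist_eq_one_iff_adj.2 hwu
  have hwv' := dist_eq_one_iff_adj.2 hwv
  have hbu' := dist_eq_one_iff_adj.2 hbu
  have hbv' := dist_eq_one_iff_adj.2 hbv
  have hlt : ∀ {a y}, (∀ i, 4 ≤ i → G.layer a i = ∅) → G.dist a y < 4 := by
    intro a y ha
    by_contra! hge
    have := ha _ hge
    exact Finset.notMem_empty y (this ▸ mem_layer.2 rfl)
  have hb : ∀ y, G.dist w y = 3 → G.dist b y = 2 := by
    intro y hy
    have h1 := h.connected.dist_adj_le hwb y
    have h2 := hlt (y := y) hb4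
    have h3 : G.dist b y ≠ 3 := by
      intro hby
      have hT := h.equidistant_eq (w := u) (x := v) huv hwb.ne
        (by rw [G.dist_comm, G.dist_comm (v := b)]; lia)
        (by rw [G.dist_comm, G.dist_comm (v := b)]; lia)
      have hyT : y ∈ G.equidistant {w, b} := by
        rw [mem_equidistant_pair, G.dist_comm, G.dist_comm (v := b)]; lia
      rw [hT, Finset.mem_insert, Finset.mem_singleton] at hyT
      rcases hyT with rfl | rfl <;> lia
    lia
  obtain ⟨z, hz⟩ := hw3
  rw [mem_layer] at hz
  have huniq : ∀ y, G.dist w y = 3 → y = z := by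
    intro y hy
    by_contra hne
    rcases h.mem_pair hwb.ne hne (hy.trans hz.symm) ((hb y hy).trans (hb z hz).symm) huv
      (hwu'.trans hwv'.symm) (hbu'.trans hbv'.symm) with rfl | rfl <;> lia
  have hwz : w ≠ z := by rintro rfl; simp at hz
  have hsub : G.layer z 1 ⊆ G.layer w 2 := by
    intro y hy
    rw [mem_layer_one] at hy
    rw [mem_layer]
    have h1 := h.connected.dist_adj_le hy w
    rw [G.dist_comm, hz, G.dist_comm] at h1
    have h2 := hlt (y := y) hw4
    have h3 : G.dist w y ≠ 3 := fun h3 => hy.ne (huniq y h3).symm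
    lia
  have h1z := h.two_le_card_layer_one hn z
  have heq := Finset.eq_of_subset_of_card_le hsub (hw2.trans h1z)
  have hz2 : (G.layer z 1).card = 2 := le_antisymm (heq ▸ hw2) h1z
  rcases h.card_layer_cases hn z with ⟨hA, -⟩ | ⟨j, -, -, hj, -, -, -, hj4, -⟩
  · have := hA 1 le_rfl
    lia
  · have hj1 : j ≠ 1 := by rintro rfl; lia
    have hcard : 3 ≤ ((G.layer z j).erase w).card := by
      have := Finset.pred_card_le_card_erase (s := G.layer z j) (a := w)
      lia
    refine hcard.not_gt (Nat.lt_succ_of_le (h.card_le_two hwz (i := 1) (j := j) ?_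
      (Finset.erase_subset _ _)))
    intro y hy
    rw [Finset.mem_erase, mem_layer] at hy
    have hy2 : G.dist w y ≠ 2 := by
      intro h2
      have : y ∈ G.layer z 1 := heq ▸ mem_layer.2 h2
      rw [mem_layer] at this
      exact hj1 (hy.2.symm.trans this)
    have hy3 : G.dist w y ≠ 3 := by
      intro h3
      have hyz := huniq y h3
      rw [hyz, dist_self] at hy
      lia
    have h0 : 0 < G.dist w y := h.connected.pos_dist_of_ne hy.1.symm
    have h4 := hlt (y := y) hw4
    rw [mem_layer]
    lia

theorem card_layer_one_ne_four (hn : 5 ≤ Fintype.card V) (w : V) : (G.layer w 1).card ≠ 4 := by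
  intro h4
  obtain ⟨a, b, c, d, hab, hac, had, hbc, hbd, hcd, hs⟩ := Finset.card_eq_four.1 h4
  have hmem : ∀ y, y = a ∨ y = b ∨ y = c ∨ y = d → G.Adj w y := by
    intro y hy; rw [← mem_layer_one, hs]; simpa using hy
  have ha := hmem a (by simp)
  have hb := hmem b (by simp)
  have hc := hmem c (by simp)
  have hd := hmem d (by simp)
  have hdist : ∀ {y}, G.Adj w y → G.dist w y = 1 := fun hy => dist_eq_one_iff_adj.2 hy
  -- If `x` and `y` were adjacent, neither could be adjacent to `s` or `t`, and then `w`, `x`, `y`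
  -- would all collide on `{s, t}`.
  have key : ∀ x y s t, G.Adj w x → G.Adj w y → G.Adj w s → G.Adj w t → x ≠ s → x ≠ t → y ≠ s →
      y ≠ t → s ≠ t → ¬ G.Adj x y := by
    intro x y s t hx hy hs ht hxs hxt hys hyt hst hxy
    have d1 := h.dist_eq_two hx hs hxs fun e =>
      hys (h.not_common_neighbors hn hx hy hs hxy e)
    have d2 := h.dist_eq_two hx ht hxt fun e =>
      hyt (h.not_common_neighbors hn hx hy ht hxy e)
    have d3 := h.dist_eq_two hy hs hys fun e =>
      hxs (h.not_common_neighbors hn hy hx hs hxy.symm e)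
    have d4 := h.dist_eq_two hy ht hyt fun e =>
      hxt (h.not_common_neighbors hn hy hx ht hxy.symm e)
    have hT := h.equidistant_eq hx.ne hst ((hdist hs).trans (hdist ht).symm) (d1.trans d2.symm)
    have hyT : y ∈ G.equidistant {s, t} := mem_equidistant_pair.2 (d3.trans d4.symm)
    rw [hT, Finset.mem_insert, Finset.mem_singleton] at hyT
    rcases hyT with rfl | rfl
    exacts [hy.ne rfl, hxy.ne rfl]
  have hsub : ({b, c, d} : Finset V) ⊆ G.layer w 1 := by
    rw [hs]; exact Finset.subset_insert _ _
  have hsub' : ({b, c, d} : Finset V) ⊆ G.layer a 2 := by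
    intro y hy
    simp only [Finset.mem_insert, Finset.mem_singleton] at hy
    rw [mem_layer]
    rcases hy with rfl | rfl | rfl
    · exact h.dist_eq_two ha hb hab (key a _ c d ha hb hc hd hac had hbc hbd hcd)
    · exact h.dist_eq_two ha hc hac (key a _ b d ha hc hb hd hab had hbc.symm hcd hbd)
    · exact h.dist_eq_two ha hd had (key a _ b c ha hd hb hc hab hac hbd.symm hcd.symm hbc)
  have := h.card_le_two ha.ne hsub hsub'
  rw [Finset.card_eq_three.2 ⟨b, c, d, hbc, hbd, hcd, rfl⟩] at this
  lia

/-- The single collision shared by `w` and `x` is used up among the neighbours of `w`, so none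
remains for the other layers. -/
theorem collision_mem_layer_one {w : V} (h3 : (G.layer w 1).card = 3) :
    ∃ x, G.Adj w x ∧ ∀ u v, u ≠ v → G.dist w u = G.dist w v → G.dist x u = G.dist x v →
      G.dist w u = 1 := by
  obtain ⟨x, u, v, hx, hu, hv, huv, he⟩ :=
    exists_collision_of_card_layer_one_eq_three h.connected h3
  have hu := dist_eq_one_iff_adj.2 hu
  have hv := dist_eq_one_iff_adj.2 hv
  refine ⟨x, hx, fun u' v' huv' hw' hx' => ?_⟩
  rcases h.mem_pair hx.ne huv' hw' hx' huv (hu.trans hv.symm) he with rfl | rfl <;> assumption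

theorem card_layer_ne_four {w : V} (h3 : (G.layer w 1).card = 3) (j : ℕ) :
    (G.layer w j).card ≠ 4 := by
  intro hj
  obtain ⟨x, hx, hcol⟩ := h.collision_mem_layer_one h3
  obtain ⟨u, hu, v, hv, huv, he⟩ := h.exists_collision hx (Finset.Subset.refl _) hj.ge
  rw [mem_layer] at hu hv
  have := hcol u v huv (hu.trans hv.symm) he
  rw [← hu, this] at hj
  lia

theorem card_lt_five : Fintype.card V < 5 := by
  by_contra! hn
  have hdeg : ∀ w, (G.layer w 1).card = 2 ∨ (G.layer w 1).card = 3 := by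
    intro w
    have h1 := h.two_le_card_layer_one hn w
    have h2 := h.card_layer_le_four hn w 1
    have h3 := h.card_layer_one_ne_four hn w
    lia
  by_cases hall : ∀ w, (G.layer w 1).card ≤ 2
  · obtain ⟨w⟩ := h.connected.nonempty
    rcases h.card_layer_cases hn w with ⟨hA, -⟩ | ⟨j, -, -, hj, -, -, -, hj4, -⟩
    · have := hA 1 le_rfl
      have := hdeg w
      have := hall w
      lia
    · have := card_layer_le_of_forall_card_layer_one_le h.connected hall w hj
      have := hall w
      lia
  · push Not at hall
    obtain ⟨w, hw⟩ := hall
    have hwmod : ∃ t, Fintype.card V = 1 + 3 * t := by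
      rcases h.card_layer_cases hn w with ⟨-, ht⟩ | ⟨j, -, -, -, -, -, -, hj4, -⟩
      · exact ht
      · exact absurd hj4 (h.card_layer_ne_four (by have := hdeg w; lia) j)
    obtain ⟨t, ht⟩ := hwmod
    have hthree : ∀ x, (G.layer x 1).card = 3 := by
      intro x
      by_contra hne
      have h2 : (G.layer x 1).card = 2 := by have := hdeg x; lia
      rcases h.card_layer_cases hn x with
        ⟨hA, -⟩ | ⟨j, p, q, hj, hp, hq, hpq, hj4, hp', hq', hrest, s, hs⟩
      · have := hA 1 le_rfl
        lia
      · have h1 : 1 = p ∨ 1 = q := by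
          by_contra hcon
          have := hrest 1 le_rfl (by rintro rfl; lia) (by tauto) (by tauto)
          lia
        -- Here the order is 7 plus 1 or 2 modulo 3, hence not 1.
        rcases h1 with rfl | rfl <;> lia
    have : Nonempty V := ⟨w⟩
    obtain ⟨⟨y, z⟩, hmax⟩ := Finite.exists_max fun p : V × V => G.dist p.1 p.2
    have hmax : ∀ a b, G.dist a b ≤ G.dist y z := fun a b => hmax (a, b)
    have hD : 2 ≤ G.dist y z := by
      by_contra! hlt
      have hsub : (Finset.univ : Finset V) ⊆ insert y (G.layer y 1) := by
        intro u _
        have h1 := hmax y u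
        rw [Finset.mem_insert, mem_layer]
        by_cases hyu : y = u
        · exact Or.inl hyu.symm
        · have := h.connected.pos_dist_of_ne hyu
          lia
      have h1 := Finset.card_le_card hsub
      have h2 := Finset.card_insert_le y (G.layer y 1)
      rw [hthree y] at h2
      rw [Finset.card_univ] at h1
      lia
    have hlast : 3 ≤ (G.layer y (G.dist y z)).card := by
      have hpos : 0 < (G.layer y (G.dist y z)).card := Finset.card_pos.2 ⟨z, by simp⟩
      rcases h.card_layer_cases hn y with ⟨hA, -⟩ | ⟨j, -, -, -, -, -, -, hj4, -⟩
      · have := hA (G.dist y z) (by lia)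
        lia
      · exact absurd hj4 (h.card_layer_ne_four (hthree y) j)
    obtain ⟨x, hx, hcol⟩ := h.collision_mem_layer_one (hthree y)
    -- The distance is the diameter, so from `x` only two values remain for at least three vertices;
    -- the resulting collision lies outside layer 1.
    obtain ⟨u, hu, v, hv, huv, he⟩ := Finset.exists_ne_map_eq_of_card_lt_of_maps_to
      (s := G.layer y (G.dist y z)) (t := {G.dist y z - 1, G.dist y z})
      (f := fun u => G.dist x u) (lt_of_le_of_lt Finset.card_le_two hlast) (by
        intro u hu
        have hu : G.dist y u = G.dist y z := by simpa using hu
        have h1 := h.connected.dist_adj_le hx u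
        have h2 := hmax x u
        simp; lia)
    rw [mem_layer] at hu hv
    have := hcol u v huv (hu.trans hv.symm) he
    lia

end HasUniqueCollisions

end ThreeDimensional

end SimpleGraph

theorem mainTheorem1 {V : Type*} [Finite V] (G : SimpleGraph V) (hG : G.Connected)
    (k : ℕ) (hdim : G.metricDimension = k) (hk : 1 < k) :
    G.IsRandomlyDimensional k ↔
      (Nonempty (G ≃g SimpleGraph.completeGraph (Fin (k + 1))) ∨ G.IsOddCycle) := by
  classical
  have := Fintype.ofFinite V
  constructor
  · intro h
    have hcomplete : k + 1 = Fintype.card V →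
        Nonempty (G ≃g SimpleGraph.completeGraph (Fin (k + 1))) := by
      intro hcard
      obtain rfl := h.eq_top hG hk hcard
      exact ⟨SimpleGraph.Iso.completeGraph (Fintype.equivFinOfCardEq hcard.symm)⟩
    rcases h.eq_two_or_eq_three_or hG hk with rfl | rfl | hcard
    · exact Or.inr (h.isOddCycle hG)
    · have h1 := (h.hasUniqueCollisions hG).card_lt_five
      have h2 := h.lt_card hG (by lia)
      exact Or.inl (hcomplete (by lia))
    · exact Or.inl (hcomplete hcard)
  · rintro (⟨⟨f⟩⟩ | h)
    · exact SimpleGraph.isRandomlyDimensional_of_iso_completeGraph hdim f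
    · exact h.isRandomlyDimensional hdim hk hG
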